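/- **Setting.** Let $K\ge 2$, $d\ge 1$, $T\ge 2$ be integers and $0<\underline q<\overline q$. A model instance has a set $\mathcal A$ of $K$ actions, one of which is a null action $a_0$; $d$ resources with a common budget $B\ge 0$; demand volumes $q_1,\dots,q_T\in[\underline q,\overline q]$, with total $Q=\sum_{t=1}^T q_t$; and outcome distributions $P_{a,t}$ ($a\in\mathcal A$, $1\le t\le T$) on $[0,1]^{d+1}$ whose mean does not depend on $t$, with $P_{a_0,t}$ concentrated at $0$. If action $A_t$ is chosen at time $t$, a vector $(R_t;C_{t,1},\dots,C_{t,d})\sim P_{A_t,t}$ is drawn independently of the past. Let $\tau$ be the first time $t$ such that $\sum_{s\le t}q_sC_{s,j}>B$ for some $j$ ($\tau=T+1$ if there is none); after time $\tau$ only $a_0$ may be chosen, and the total reward is $\sum_{t=1}^{\tau-1}q_tR_t$. $\mathrm{OPT}$ denotes the supremum of the expected total reward over all (randomized, history-dependent) policies that know the whole instance. A prediction oracle is a family $\mathcal F=(\mathcal F_t)_{t=1}^T$ of functions $\mathcal F_t:[\underline q,\overline q]^{t-1}\to[\underline qT,\overline qT]$. A (possibly randomized) online algorithm knows $\mathcal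 A,B,T,d$ and chooses $A_t$ from the volumes $q_1,\dots,q_{t-1}$, the predictions $\hat Q_s=\mathcal F_s(q_1,\dots,q_{s-1})$ for $s\le t$, and the actions, rewards and consumptions of the rounds before $t$. Its regret $\mathrm{Regret}_T$ on an instance is $\mathrm{OPT}$ minus its expected total reward. Let $1\le T_0\le T-1$. For $q_1,\dots,q_{T_0}\in[\underline q,\overline q]$ put $\hat Q_{T_0+1}=\mathcal F_{T_0+1}(q_1,\dots,q_{T_0})$. A number $\epsilon$ is $(T_0+1,\{q_t\}_{t=1}^{T_0})$-*well response* by $\mathcal F$ if $$\epsilon\le\min\Big\{\hat Q_{T_0+1}-\sum_{t=1}^{T_0}q_t-\underline q(T-T_0),\ \overline q(T-T_0)-\Big(\hat Q_{T_0+1}-\sum_{t=1}^{T_0}q_t\Big),\ \hat Q_{T_0+1}/2\Big\}.$$ An instance with volumes $q_1,\dots,q_T$ is $(T_0+1,\epsilon)$-*well estimated* by $\mathcal F$ if $|Q-\hat Q_{T_0+1}|\in[\epsilon,2\epsilon]$. **Theorem 1.** There is an absolute constant $c>0$ such that the following holds for all $K\ge2$, $d\ge1$, $T\ge2$, $0<\underline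 q<\overline q$, every prediction oracle $\mathcal F$ and every online algorithm. For every $T_0\in\{1,\dots,T-1\}$, all $q_1,\dots,q_{T_0}\in[\underline q,\overline q]$ and every $\epsilon_{T_0+1}>0$ that is $(T_0+1,\{q_t\}_{t=1}^{T_0})$-well response by $\mathcal F$, there is an instance with $K$ actions, $d$ resources, horizon $T$ and some budget $B>0$, whose first $T_0$ demand volumes are $q_1,\dots,q_{T_0}$, which is $(T_0+1,\epsilon_{T_0+1})$-well estimated by $\mathcal F$ and on which $$\mathrm{Regret}_T\ \ge\ c\,\max\Big\{\frac1Q\sum_{t=1}^{T_0}q_t\,\epsilon_{T_0+1},\ \Lambda\Big\},\qquad \Lambda=\min\Big\{\mathrm{OPT},\ \mathrm{OPT}\sqrt{\frac{\overline qK}{B}}+\sqrt{\overline qK\,\mathrm{OPT}}\Big\}.$$ -/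

import Mathlib

open MeasureTheory ProbabilityTheory

noncomputable section

namespace BwK

/-- A vector of random outcomes `(R; C₁, …, C_d) ∈ [0,1]^{d+1}`: the reward and the amounts of the
`d` resources consumed, both per unit of demand. -/
abbrev Outcome (d : ℕ) : Type := unitInterval × (Fin d → unitInterval)

/-- What is recorded in one round: the chosen action and the realized outcome vector. -/
abbrev Record (K d : ℕ) : Type := Fin K × Outcome d

/-- A model instance with `K` actions, null action `a₀`, `d` resources, horizon `T` and demand
volumes in `[ql, qu]`. Rounds are indexed by `Fin T`, so round `t` of the usual numbering
`1, …, T` is the index `t - 1`. -/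
structure Instance (K d T : ℕ) (a₀ : Fin K) (ql qu : ℝ) where
  /-- The common budget `B` of all resources. -/
  budget : ℝ
  budget_nonneg : 0 ≤ budget
  /-- The demand volumes. -/
  demand : Fin T → ℝ
  demand_mem : ∀ t, demand t ∈ Set.Icc ql qu
  /-- The latent outcome distribution of an action in a round. -/
  law : Fin K → Fin T → Measure (Outcome d)
  law_prob : ∀ a t, IsProbabilityMeasure (law a t)
  /-- The distributions of an action may vary over time, but they share their mean rewards. -/
  mean_reward : ∀ a t t', ∫ x, (x.1 : ℝ) ∂(law a t) = ∫ x, (x.1 : ℝ) ∂(law a t')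
  /-- They also share their mean consumption of each resource. -/
  mean_consumption : ∀ a i t t', ∫ x, (x.2 i : ℝ) ∂(law a t) = ∫ x, (x.2 i : ℝ) ∂(law a t')
  /-- The null action yields no reward and consumes nothing. -/
  law_null : ∀ t, law a₀ t = Measure.dirac (0, fun _ => 0)

/-- A prediction oracle. In the round with index `n`, after `n` demand volumes have been observed,
`pred n` maps them to a prediction in `[ql T, qu T]` of the total demand volume. -/
structure Oracle (T : ℕ) (ql qu : ℝ) where
  pred : (n : ℕ) → (Fin n → ℝ) → ℝ
  pred_mem : ∀ n, n < T → ∀ x : Fin n → ℝ, (∀ i, x i ∈ Set.Icc ql qu) →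
    pred n x ∈ Set.Icc (ql * T) (qu * T)

/-- A (randomized, history dependent) decision rule: in round `t`, the conditional distribution of
the action given the actions and outcomes of the previous rounds. -/
structure Strategy (K d T : ℕ) where
  act : (t : Fin T) → Kernel (Fin (t : ℕ) → Record K d) (Fin K)
  markov : ∀ t, IsMarkovKernel (act t)

/-- A (randomized) online policy. In round `t` it may use the demand volumes of the previous
rounds, the predictions received up to and including round `t`, and the actions and outcomes of
the previous rounds. (As the volumes are positive and observed, observing the total reward and
consumption `q_s R_s`, `q_s C_s` is the same as observing `R_s`, `C_s`.) -/
structure Policy (K d T : ℕ) where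
  act : (t : Fin T) → (volumes : Fin (t : ℕ) → ℝ) → (predictions : Fin ((t : ℕ) + 1) → ℝ) →
    Kernel (Fin (t : ℕ) → Record K d) (Fin K)
  markov : ∀ t v p, IsMarkovKernel (act t v p)

/-- The first `n` entries of a sequence of length `T`. -/
def pre {T : ℕ} (q : Fin T → ℝ) (n : ℕ) (hn : n ≤ T) : Fin n → ℝ :=
  fun i => q (Fin.castLE hn i)

/-- The decision rule that results when an online policy is run on the demand volumes `q` with the
predictions of the oracle `F`. -/
def Policy.run {K d T : ℕ} {ql qu : ℝ} (π : Policy K d T) (F : Oracle T ql qu) (q : Fin T → ℝ) :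
    Strategy K d T where
  act t := π.act t (pre q t t.isLt.le)
    (fun s => F.pred s (pre q s (s.is_le.trans t.isLt.le)))
  markov t := π.markov t _ _

namespace Instance

variable {K d T : ℕ} {a₀ : Fin K} {ql qu : ℝ}

/-- The total demand volume `Q`. -/
def total (I : Instance K d T a₀ ql qu) : ℝ := ∑ t, I.demand t

/-- The outcome distribution of round `t` as a function of the action. -/
def outcomeKernel (I : Instance K d T a₀ ql qu) (t : Fin T) : Kernel (Fin K) (Outcome d) :=
  Kernel.ofFunOfCountable fun a => I.law a t

instance instIsMarkovKernelOutcomeKernel (I : Instance K d T a₀ ql qu) (t : Fin T) : IsMarkovKernel (I.outcomeKernel t) :=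
  ⟨fun a => I.law_prob a t⟩

/-- The round with index `n`: given the history, draw the action `A` from the rule `σ`, then the
outcome vector from the latent distribution of `A` in that round. -/
def step (I : Instance K d T a₀ ql qu) (σ : Strategy K d T) (n : ℕ) (hn : n < T) :
    Kernel (Fin n → Record K d) (Record K d) :=
  Kernel.compProd (β := Fin K) (σ.act ⟨n, hn⟩)
    (Kernel.prodMkLeft (Fin n → Record K d) (I.outcomeKernel ⟨n, hn⟩))

instance instIsMarkovKernelStep (I : Instance K d T a₀ ql qu) (σ : Strategy K d T) (n : ℕ)
    (hn : n < T) : IsMarkovKernel (I.step σ n hn) := by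
  have : @IsMarkovKernel (Fin n → Record K d) (Fin K) _ _ (σ.act ⟨n, hn⟩) := σ.markov ⟨n, hn⟩
  exact Kernel.IsMarkovKernel.compProd _ _

/-- The joint law of the first `n` rounds under the rule `σ`. -/
def runLaw (I : Instance K d T a₀ ql qu) (σ : Strategy K d T) :
    (n : ℕ) → n ≤ T → Measure (Fin n → Record K d)
  | 0, _ => Measure.dirac Fin.elim0
  | n + 1, hn =>
      ((I.runLaw σ n (Nat.le_of_succ_le hn)) ⊗ₘ (I.step σ n hn)).map
        (fun p => Fin.snoc (α := fun _ => Record K d) p.1 p.2)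

instance instIsProbabilityMeasureRunLaw (I : Instance K d T a₀ ql qu) (σ : Strategy K d T) :
    ∀ (n : ℕ) (hn : n ≤ T), IsProbabilityMeasure (I.runLaw σ n hn)
  | 0, _ => by unfold runLaw; infer_instance
  | n + 1, hn => by
    have := instIsProbabilityMeasureRunLaw I σ n (Nat.le_of_succ_le hn)
    unfold runLaw
    refine Measure.isProbabilityMeasure_map (Measurable.aemeasurable ?_)
    refine measurable_pi_lambda _ fun i => ?_
    refine Fin.lastCases ?_ (fun i => ?_) i
    · simp only [Fin.snoc_last]; exact measurable_snd
    · simp only [Fin.snoc_castSucc]; exact (measurable_pi_apply i).comp measurable_fst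

/-- The amount of resource `i` consumed up to and including round `t`. -/
def spent (I : Instance K d T a₀ ql qu) (h : Fin T → Record K d) (i : Fin d) (t : Fin T) : ℝ :=
  ∑ s ∈ Finset.Iic t, I.demand s * ((h s).2.2 i : ℝ)

/-- Round `t` precedes the stopping time `τ`, the first round at the end of which the consumption
of some resource exceeds the budget. -/
def Before (I : Instance K d T a₀ ql qu) (h : Fin T → Record K d) (t : Fin T) : Prop :=
  ∀ s ≤ t, ∀ i, I.spent h i s ≤ I.budget

open Classical in
/-- The total reward `∑_{t < τ} q_t R_t`. No reward is counted from round `τ` on, so it does not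
matter for it that the null action has to be chosen after the depletion of a resource. -/
def reward (I : Instance K d T a₀ ql qu) (h : Fin T → Record K d) : ℝ :=
  ∑ t, if I.Before h t then I.demand t * ((h t).2.1 : ℝ) else 0

/-- The total reward is measurable, and it is bounded, so its expectation is meaningful. -/
theorem measurable_reward (I : Instance K d T a₀ ql qu) : Measurable I.reward := by
  unfold reward
  refine Finset.measurable_sum _ fun t _ => Measurable.ite ?_ ?_ measurable_const
  · have hs : ∀ i s, Measurable fun h => I.spent h i s := by
      intro i s; unfold spent; fun_prop
    simp only [Before, Set.ofPred_forall]
    exact MeasurableSet.iInter fun s => MeasurableSet.iInter fun _ => MeasurableSet.iInter fun i =>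
      measurableSet_le (hs i s) measurable_const
  · fun_prop

/-- The expected total reward of a decision rule. -/
def expectedReward (I : Instance K d T a₀ ql qu) (σ : Strategy K d T) : ℝ :=
  ∫ h, I.reward h ∂(I.runLaw σ T le_rfl)

/-- `OPT`: the optimal expected total reward of a dynamic policy that knows the whole instance. -/
def opt (I : Instance K d T a₀ ql qu) : ℝ :=
  ⨆ σ : Strategy K d T, I.expectedReward σ

/-- `OPT` is a genuine supremum. -/
theorem bddAbove_expectedReward (hq : 0 < ql) (I : Instance K d T a₀ ql qu) :
    BddAbove (Set.range fun σ => I.expectedReward σ) := by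
  refine ⟨I.total, ?_⟩
  rintro _ ⟨σ, rfl⟩
  have h := norm_integral_le_of_norm_le_const (μ := I.runLaw σ T le_rfl) (f := I.reward) (C := I.total)
    (Filter.Eventually.of_forall fun h => by
      have h0 : ∀ t, 0 ≤ I.demand t := fun t => hq.le.trans (I.demand_mem t).1
      have hp : 0 ≤ I.reward h := Finset.sum_nonneg fun t _ => by
        split_ifs; exacts [mul_nonneg (h0 t) (h t).2.1.2.1, le_rfl]
      rw [Real.norm_of_nonneg hp]
      refine Finset.sum_le_sum fun t _ => ?_
      split_ifs
      · exact mul_le_of_le_one_right (h0 t) (h t).2.1.2.2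
      · exact h0 t)
  simp at h
  exact (le_abs_self _).trans h

/-- The (expected) regret of an online policy that uses the predictions of the oracle `F`. -/
def regret (I : Instance K d T a₀ ql qu) (F : Oracle T ql qu) (π : Policy K d T) : ℝ :=
  I.opt - I.expectedReward (π.run F I.demand)

/-- The instance is `(T₀ + 1, ε)`-well estimated by the oracle `F`. -/
def WellEstimated (I : Instance K d T a₀ ql qu) (F : Oracle T ql qu) (T₀ : ℕ) (hT₀ : T₀ ≤ T)
    (ε : ℝ) : Prop :=
  |I.total - F.pred T₀ (pre I.demand T₀ hT₀)| ∈ Set.Icc ε (2 * ε)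

/-- `Λ = min {OPT, OPT √(q̄ K / B) + √(q̄ K OPT)}`. -/
def Lam (I : Instance K d T a₀ ql qu) : ℝ :=
  min I.opt (I.opt * √(qu * K / I.budget) + √(qu * K * I.opt))

end Instance

/-- `ε` is `(T₀ + 1, {q_t}_{t ≤ T₀})`-well response by the oracle `F`. -/
def WellResponse {T : ℕ} {ql qu : ℝ} (F : Oracle T ql qu) (T₀ : ℕ) (q : Fin T₀ → ℝ) (ε : ℝ) :
    Prop :=
  ε ≤ min (F.pred T₀ q - ∑ s, q s - ql * ((T : ℝ) - T₀))
    (min (qu * ((T : ℝ) - T₀) - (F.pred T₀ q - ∑ s, q s)) (F.pred T₀ q / 2))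

end BwK

end

noncomputable section

namespace BwK

variable {K d T : ℕ} {a₀ : Fin K} {ql qu : ℝ}

/-! Since `Λ ≤ OPT`, it suffices to find an instance on which the algorithm misses a constant
fraction of `OPT`, while `OPT` is at least a constant times `S ε / Q`, where `S` is the volume of
the first `T₀` rounds. Only the means of the outcomes are fixed in time. So take a tiny budget and
let every non-null action pay 1 and exhaust the resources with probability `p t`, the consumption
then being `m / p t`: its mean is `m` whatever the hazard `p t` is.

Two instances share budget, volumes and the first `T₀` rounds. Afterwards the hazard is 1 in one of
them (nothing more can be earned) and the tiny `m` in the other (almost all the remaining volume `W`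
can be earned). In the first rounds the hazard is `q / (θ + q)`, so that `(1 - p) (q + θ) = θ`: if
survival is worth `θ`, playing and waiting are equally good. Hence every policy obeys `A + θ α ≤ θ`,
with `A` its early reward and `α` its survival probability (`potential_le_of_hazard`). If `A ≤ θ /
2`, it is too timid for the deadly future; otherwise `α ≤ 1 / 2`, and it is too greedy for the
harmless one.

All bounds on rewards come from a Bellman inequality for `earned + v * alive` (`potential_le_of_le`,
`le_potential_of_le`). -/

/-! ### Survival and the reward earned while surviving. -/

/-- The indicator that all outcomes of a history lie in the prescribed sets. -/
def alive (D : ℕ → Set (Outcome d)) : (n : ℕ) → (Fin n → Record K d) → ℝ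
  | 0, _ => 1
  | n + 1, h => alive D n (Fin.init h) * (D n).indicator 1 (h (Fin.last n)).2

/-- The reward, with volumes `Q`, of the rounds of a history up to which it is alive. -/
def earned (Q : ℕ → ℝ) (D : ℕ → Set (Outcome d)) : (n : ℕ) → (Fin n → Record K d) → ℝ
  | 0, _ => 0
  | n + 1, h => earned Q D n (Fin.init h) + alive D (n + 1) h * (Q n * ((h (Fin.last n)).2.1 : ℝ))

theorem measurable_init (n : ℕ) :
    Measurable (fun h : Fin (n + 1) → Record K d => (Fin.init h : Fin n → Record K d)) :=
  measurable_pi_lambda _ fun i => measurable_pi_apply i.castSucc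

theorem measurable_alive {D : ℕ → Set (Outcome d)} (hD : ∀ n, MeasurableSet (D n)) :
    ∀ n, Measurable (alive (K := K) D n)
  | 0 => measurable_const
  | n + 1 => by
    refine ((measurable_alive hD n).comp (measurable_init n)).mul ?_
    exact (measurable_one.indicator (hD n)).comp
      (measurable_snd.comp (measurable_pi_apply (Fin.last n)))

theorem measurable_earned (Q : ℕ → ℝ) {D : ℕ → Set (Outcome d)} (hD : ∀ n, MeasurableSet (D n)) :
    ∀ n, Measurable (earned (K := K) Q D n)
  | 0 => measurable_const
  | n + 1 => by
    refine ((measurable_earned Q hD n).comp (measurable_init n)).add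
      ((measurable_alive hD (n + 1)).mul (measurable_const.mul ?_))
    exact measurable_subtype_coe.comp
      (measurable_fst.comp (measurable_snd.comp (measurable_pi_apply (Fin.last n))))

theorem alive_mem (D : ℕ → Set (Outcome d)) :
    ∀ n (h : Fin n → Record K d), alive D n h ∈ Set.Icc (0 : ℝ) 1
  | 0, _ => by simp [alive]
  | n + 1, h => by
    have h1 := alive_mem D n (Fin.init h)
    by_cases hx : (h (Fin.last n)).2 ∈ D n <;> simp [alive, hx, h1.1, h1.2]

theorem abs_earned_le (Q : ℕ → ℝ) (D : ℕ → Set (Outcome d)) :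
    ∀ n (h : Fin n → Record K d), |earned Q D n h| ≤ ∑ i ∈ Finset.range n, |Q i|
  | 0, _ => by simp [earned]
  | n + 1, h => by
    rw [Finset.sum_range_succ]
    refine (abs_add_le _ _).trans (add_le_add (abs_earned_le Q D n _) ?_)
    have h1 := alive_mem D (n + 1) h
    have h2 := (h (Fin.last n)).2.1.2
    rw [abs_mul, abs_mul, abs_of_nonneg h1.1, abs_of_nonneg h2.1]
    have := mul_le_mul_of_nonneg_left h2.2 (abs_nonneg (Q n))
    have h3 : 0 ≤ |Q n| * ((h (Fin.last n)).2.1 : ℝ) := mul_nonneg (abs_nonneg _) h2.1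
    nlinarith [h1.2]

theorem integrable_alive {D : ℕ → Set (Outcome d)} (hD : ∀ n, MeasurableSet (D n)) (n : ℕ)
    (μ : Measure (Fin n → Record K d)) [IsFiniteMeasure μ] : Integrable (alive D n) μ :=
  Integrable.of_bound (measurable_alive hD n).aestronglyMeasurable 1 <|
    Filter.Eventually.of_forall fun h => by
      rw [Real.norm_of_nonneg (alive_mem D n h).1]; exact (alive_mem D n h).2

theorem integrable_earned (Q : ℕ → ℝ) {D : ℕ → Set (Outcome d)} (hD : ∀ n, MeasurableSet (D n))
    (n : ℕ) (μ : Measure (Fin n → Record K d)) [IsFiniteMeasure μ] : Integrable (earned Q D n) μ :=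
  Integrable.of_bound (measurable_earned Q hD n).aestronglyMeasurable _ <|
    Filter.Eventually.of_forall (abs_earned_le Q D n)

/-! ### The potential and its one-step drift. -/

/-- The gain of a round with volume `q` that continues with value `v` if its outcome is in `D`. -/
def gain (q v : ℝ) (D : Set (Outcome d)) (x : Outcome d) : ℝ := D.indicator 1 x * (q * (x.1 : ℝ) + v)

theorem measurable_gain (q v : ℝ) {D : Set (Outcome d)} (hD : MeasurableSet D) :
    Measurable (gain q v D) :=
  (measurable_one.indicator hD).mul
    ((measurable_const.mul (measurable_subtype_coe.comp measurable_fst)).add_const v)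

theorem abs_gain_le (q v : ℝ) (D : Set (Outcome d)) (x : Outcome d) :
    |gain q v D x| ≤ |q| + |v| := by
  by_cases hx : x ∈ D
  · simp only [gain, hx, Set.indicator_of_mem, Pi.one_apply, one_mul]
    refine (abs_add_le _ _).trans ?_
    rw [abs_mul, abs_of_nonneg x.1.2.1]
    have := mul_le_of_le_one_right (abs_nonneg q) x.1.2.2
    linarith
  · simp [gain, hx]; positivity

theorem earned_add_alive_snoc (Q : ℕ → ℝ) (D : ℕ → Set (Outcome d)) (n : ℕ) (v : ℝ)
    (h : Fin n → Record K d) (x : Record K d) :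
    earned Q D (n + 1) (Fin.snoc (α := fun _ => Record K d) h x)
        + v * alive D (n + 1) (Fin.snoc (α := fun _ => Record K d) h x) =
      earned Q D n h + alive D n h * gain (Q n) v (D n) x.2 := by
  simp only [earned, alive, gain, Fin.init_snoc, Fin.snoc_last]
  ring

/-- The expected gain of one round, given the history. -/
def meanGain (I : Instance K d T a₀ ql qu) (σ : Strategy K d T) (D : Set (Outcome d)) (q v : ℝ)
    (n : ℕ) (hn : n < T) (h : Fin n → Record K d) : ℝ :=
  ∫ a, ∫ x, gain q v D x ∂(I.law a ⟨n, hn⟩) ∂(σ.act ⟨n, hn⟩ h)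

/-- The expected potential `earned + v * alive` after `n` rounds. -/
def potential (I : Instance K d T a₀ ql qu) (σ : Strategy K d T) (Q : ℕ → ℝ)
    (D : ℕ → Set (Outcome d)) (n : ℕ) (hn : n ≤ T) (v : ℝ) : ℝ :=
  ∫ h, (earned Q D n h + v * alive D n h) ∂(I.runLaw σ n hn)

theorem integral_gain_step (I : Instance K d T a₀ ql qu) (σ : Strategy K d T)
    {D : Set (Outcome d)} (hD : MeasurableSet D) (q v : ℝ) (n : ℕ) (hn : n < T)
    (h : Fin n → Record K d) :
    ∫ x, gain q v D x.2 ∂(I.step σ n hn h) = meanGain I σ D q v n hn h := by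
  have : @IsMarkovKernel (Fin n → Record K d) (Fin K) _ _ (σ.act ⟨n, hn⟩) := σ.markov ⟨n, hn⟩
  unfold Instance.step
  rw [ProbabilityTheory.integral_compProd]
  · rfl
  · exact Integrable.of_bound ((measurable_gain q v hD).comp measurable_snd).aestronglyMeasurable _
      (Filter.Eventually.of_forall fun x => abs_gain_le q v D x.2)

theorem measurable_snoc (n : ℕ) : Measurable (fun p : (Fin n → Record K d) × Record K d =>
    Fin.snoc (α := fun _ => Record K d) p.1 p.2) := by
  refine measurable_pi_lambda _ fun i => ?_
  refine Fin.lastCases ?_ (fun i => ?_) i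
  · simp only [Fin.snoc_last]; exact measurable_snd
  · simp only [Fin.snoc_castSucc]; exact (measurable_pi_apply i).comp measurable_fst

theorem integrable_potential (Q : ℕ → ℝ) {D : ℕ → Set (Outcome d)} (hD : ∀ n, MeasurableSet (D n))
    (n : ℕ) (v : ℝ) (μ : Measure (Fin n → Record K d)) [IsFiniteMeasure μ] :
    Integrable (fun h => earned Q D n h + v * alive D n h) μ :=
  (integrable_earned Q hD n μ).add ((integrable_alive hD n μ).const_mul v)

theorem integral_snoc_step (I : Instance K d T a₀ ql qu) (σ : Strategy K d T) (Q : ℕ → ℝ)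
    {D : ℕ → Set (Outcome d)} (hD : ∀ n, MeasurableSet (D n)) (n : ℕ) (hn : n < T) (v : ℝ)
    (h : Fin n → Record K d) :
    ∫ x, (earned Q D (n + 1) (Fin.snoc (α := fun _ => Record K d) h x)
        + v * alive D (n + 1) (Fin.snoc (α := fun _ => Record K d) h x)) ∂(I.step σ n hn h) =
      earned Q D n h + alive D n h * meanGain I σ (D n) (Q n) v n hn h := by
  simp_rw [earned_add_alive_snoc]
  rw [integral_add (integrable_const _), integral_const_mul, integral_gain_step I σ (hD n)]
  · simp
  · refine Integrable.const_mul ?_ _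
    exact Integrable.of_bound
      ((measurable_gain (Q n) v (hD n)).comp measurable_snd).aestronglyMeasurable _
      (Filter.Eventually.of_forall fun x => abs_gain_le (Q n) v (D n) x.2)

/-- Integrability of the conditional drift is a by-product of Fubini, which avoids a separate proof
that `meanGain` is measurable in the history. -/
theorem potential_succ (I : Instance K d T a₀ ql qu) (σ : Strategy K d T) (Q : ℕ → ℝ)
    {D : ℕ → Set (Outcome d)} (hD : ∀ n, MeasurableSet (D n)) (n : ℕ) (hn : n < T) (v : ℝ) :
    Integrable (fun h => earned Q D n h + alive D n h * meanGain I σ (D n) (Q n) v n hn h)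
      (I.runLaw σ n hn.le) ∧
    potential I σ Q D (n + 1) hn v =
      ∫ h, (earned Q D n h + alive D n h * meanGain I σ (D n) (Q n) v n hn h)
        ∂(I.runLaw σ n hn.le) := by
  have hm : Measurable (fun h : Fin (n + 1) → Record K d =>
      earned Q D (n + 1) h + v * alive D (n + 1) h) :=
    (measurable_earned Q hD (n + 1)).add ((measurable_alive hD (n + 1)).const_mul v)
  have hi : Integrable (fun p : (Fin n → Record K d) × Record K d =>
      earned Q D (n + 1) (Fin.snoc (α := fun _ => Record K d) p.1 p.2)
        + v * alive D (n + 1) (Fin.snoc (α := fun _ => Record K d) p.1 p.2))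
      ((I.runLaw σ n hn.le) ⊗ₘ (I.step σ n hn)) := by
    have : IsFiniteMeasure (((I.runLaw σ n hn.le) ⊗ₘ (I.step σ n hn)).map
        (fun p => Fin.snoc (α := fun _ => Record K d) p.1 p.2)) :=
      inferInstanceAs (IsFiniteMeasure (I.runLaw σ (n + 1) hn))
    exact (integrable_potential Q hD (n + 1) v _).comp_measurable (measurable_snoc n)
  constructor
  · have := Integrable.integral_compProd (κ := Kernel.const Unit (I.runLaw σ n hn.le))
      (η := Kernel.prodMkLeft Unit (I.step σ n hn)) (a := ()) hi
    simpa only [Kernel.const_apply, Kernel.prodMkLeft_apply, integral_snoc_step I σ Q hD] using this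
  · unfold potential
    rw [Instance.runLaw, integral_map (measurable_snoc n).aemeasurable hm.aestronglyMeasurable,
      Measure.integral_compProd hi]
    simp only [integral_snoc_step I σ Q hD]

theorem potential_succ_le (I : Instance K d T a₀ ql qu) (σ : Strategy K d T) (Q : ℕ → ℝ)
    {D : ℕ → Set (Outcome d)} (hD : ∀ n, MeasurableSet (D n)) (n : ℕ) (hn : n < T) (v v' : ℝ)
    (hv : ∀ a, ∫ x, gain (Q n) v' (D n) x ∂(I.law a ⟨n, hn⟩) ≤ v) :
    potential I σ Q D (n + 1) hn v' ≤ potential I σ Q D n hn.le v := by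
  obtain ⟨hi, he⟩ := potential_succ I σ Q hD n hn v'
  rw [he]
  refine integral_mono hi (integrable_potential Q hD n v _) fun h => ?_
  have : @IsMarkovKernel (Fin n → Record K d) (Fin K) _ _ (σ.act ⟨n, hn⟩) := σ.markov ⟨n, hn⟩
  have hg : meanGain I σ (D n) (Q n) v' n hn h ≤ v := by
    refine (integral_mono .of_finite (integrable_const v) hv).trans ?_
    simp
  have := mul_le_mul_of_nonneg_left hg (alive_mem D n h).1
  simp only
  linarith

theorem le_potential_succ (I : Instance K d T a₀ ql qu) (σ : Strategy K d T) (Q : ℕ → ℝ)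
    {D : ℕ → Set (Outcome d)} (hD : ∀ n, MeasurableSet (D n)) (n : ℕ) (hn : n < T) (v v' : ℝ)
    (a : Fin K) (ha : ∀ h, σ.act ⟨n, hn⟩ h = Measure.dirac a)
    (hv : v ≤ ∫ x, gain (Q n) v' (D n) x ∂(I.law a ⟨n, hn⟩)) :
    potential I σ Q D n hn.le v ≤ potential I σ Q D (n + 1) hn v' := by
  obtain ⟨hi, he⟩ := potential_succ I σ Q hD n hn v'
  rw [he]
  refine integral_mono (integrable_potential Q hD n v _) hi fun h => ?_
  have hg : v ≤ meanGain I σ (D n) (Q n) v' n hn h := by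
    rw [meanGain, ha]; simpa using hv
  have := mul_le_mul_of_nonneg_left hg (alive_mem D n h).1
  simp only
  linarith

theorem potential_zero (I : Instance K d T a₀ ql qu) (σ : Strategy K d T) (Q : ℕ → ℝ)
    (D : ℕ → Set (Outcome d)) (v : ℝ) : potential I σ Q D 0 (Nat.zero_le T) v = v := by
  simp [potential, earned, alive, Instance.runLaw]

/-- Verification by dynamic programming: if no action beats the candidate value `v` in any round,
the potential is a supermartingale under every policy. -/
theorem potential_le_of_le (I : Instance K d T a₀ ql qu) (σ : Strategy K d T) (Q : ℕ → ℝ)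
    {D : ℕ → Set (Outcome d)} (hD : ∀ n, MeasurableSet (D n)) (v : ℕ → ℝ) {k n : ℕ} (hkn : k ≤ n)
    (hn : n ≤ T)
    (hv : ∀ i (hi : i < T), k ≤ i → i < n → ∀ a,
      ∫ x, gain (Q i) (v (i + 1)) (D i) x ∂(I.law a ⟨i, hi⟩) ≤ v i) :
    potential I σ Q D n hn (v n) ≤ potential I σ Q D k (hkn.trans hn) (v k) := by
  induction n, hkn using Nat.le_induction with
  | base => exact le_rfl
  | succ n hkn ih =>
    exact (potential_succ_le I σ Q hD n hn _ _ (hv n hn hkn n.lt_succ_self)).trans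
      (ih _ fun i hi h1 h2 => hv i hi h1 (h2.trans n.lt_succ_self))

theorem le_potential_of_le (I : Instance K d T a₀ ql qu) (σ : Strategy K d T) (Q : ℕ → ℝ)
    {D : ℕ → Set (Outcome d)} (hD : ∀ n, MeasurableSet (D n)) (v : ℕ → ℝ) (act : ℕ → Fin K)
    (ha : ∀ i (hi : i < T) h, σ.act ⟨i, hi⟩ h = Measure.dirac (act i))
    (hv : ∀ i (hi : i < T),
      v i ≤ ∫ x, gain (Q i) (v (i + 1)) (D i) x ∂(I.law (act i) ⟨i, hi⟩))
    {n : ℕ} (hn : n ≤ T) : v 0 ≤ potential I σ Q D n hn (v n) := by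
  induction n with
  | zero => exact (potential_zero I σ Q D _).ge
  | succ n ih =>
    exact (ih (Nat.le_of_succ_le hn)).trans
      (le_potential_succ I σ Q hD n hn _ _ _ (ha n hn) (hv n hn))

/-- This makes the two hard instances indistinguishable until their hazards differ. -/
theorem runLaw_congr (I J : Instance K d T a₀ ql qu) (σ : Strategy K d T) (n : ℕ) (hn : n ≤ T)
    (h : ∀ a (t : Fin T), (t : ℕ) < n → I.law a t = J.law a t) :
    I.runLaw σ n hn = J.runLaw σ n hn := by
  induction n with
  | zero => rfl
  | succ n ih =>
    have hk : I.outcomeKernel ⟨n, hn⟩ = J.outcomeKernel ⟨n, hn⟩ := by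
      ext1 a; exact h a ⟨n, hn⟩ n.lt_succ_self
    simp only [Instance.runLaw, Instance.step, hk,
      ih (Nat.le_of_succ_le hn) fun a t ht => h a t (ht.trans n.lt_succ_self)]

/-! ### Instances with fixed means and prescribed depletion hazards. -/

/-- Reward `1` and, with probability `p`, the consumption `m / p` of every resource. -/
def killLaw (d : ℕ) (m p : ℝ) : Measure (Outcome d) :=
  ENNReal.ofReal (1 - p) • Measure.dirac (1, fun _ => 0) +
    ENNReal.ofReal p • Measure.dirac (1, fun _ => Set.projIcc (0 : ℝ) 1 zero_le_one (m / p))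

theorem isProbabilityMeasure_killLaw {m p : ℝ} (h0 : 0 ≤ p) (h1 : p ≤ 1) :
    IsProbabilityMeasure (killLaw d m p) := by
  constructor
  simp only [killLaw, Measure.coe_add, Measure.coe_smul, Pi.add_apply, Pi.smul_apply, measure_univ,
    smul_eq_mul, mul_one]
  rw [← ENNReal.ofReal_add (by linarith) h0]
  simp

theorem integral_killLaw {m p : ℝ} (h0 : 0 ≤ p) (h1 : p ≤ 1) {f : Outcome d → ℝ}
    (hf : Measurable f) :
    ∫ x, f x ∂(killLaw d m p) = (1 - p) * f (1, fun _ => 0) +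
      p * f (1, fun _ => Set.projIcc (0 : ℝ) 1 zero_le_one (m / p)) := by
  have hi : ∀ y : Outcome d, Integrable f (Measure.dirac y) := fun y =>
    integrable_dirac' hf.stronglyMeasurable (by simp)
  rw [killLaw, integral_add_measure ((hi _).smul_measure ENNReal.ofReal_ne_top)
    ((hi _).smul_measure ENNReal.ofReal_ne_top), integral_smul_measure, integral_smul_measure,
    integral_dirac' _ _ hf.stronglyMeasurable, integral_dirac' _ _ hf.stronglyMeasurable,
    ENNReal.toReal_ofReal (by linarith), ENNReal.toReal_ofReal h0, smul_eq_mul, smul_eq_mul]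

theorem measurable_reward_coord : Measurable fun x : Outcome d => (x.1 : ℝ) :=
  measurable_subtype_coe.comp measurable_fst

theorem measurable_consumption_coord (i : Fin d) : Measurable fun x : Outcome d => (x.2 i : ℝ) :=
  measurable_subtype_coe.comp ((measurable_pi_apply i).comp measurable_snd)

theorem coe_projIcc_div {m p : ℝ} (hm : 0 < m) (hp : m ≤ p) :
    (Set.projIcc (0 : ℝ) 1 zero_le_one (m / p) : ℝ) = m / p := by
  rw [Set.projIcc_of_mem _ (Set.mem_Icc.2
    ⟨div_nonneg hm.le (hm.le.trans hp), div_le_one_of_le₀ hp (hm.le.trans hp)⟩)]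

theorem integral_reward_killLaw {m p : ℝ} (h0 : 0 ≤ p) (h1 : p ≤ 1) :
    ∫ x, (x.1 : ℝ) ∂(killLaw d m p) = 1 := by
  rw [integral_killLaw h0 h1 measurable_reward_coord]; simp

theorem integral_consumption_killLaw {m p : ℝ} (hm : 0 < m) (hp : m ≤ p) (h1 : p ≤ 1) (i : Fin d) :
    ∫ x, (x.2 i : ℝ) ∂(killLaw d m p) = m := by
  have h0 : 0 < p := hm.trans_le hp
  rw [integral_killLaw h0.le h1 (measurable_consumption_coord i), coe_projIcc_div hm hp]
  simp only [Set.Icc.coe_zero]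
  field_simp
  ring

/-- The instance in which the null action is as it has to be and every other action has reward `1`
and depletes the resources with probability `p t` in round `t`. -/
def killInstance (K d : ℕ) {T : ℕ} (a₀ : Fin K) {ql qu : ℝ} (hql : 0 < ql) (q : Fin T → ℝ)
    (hq : ∀ t, q t ∈ Set.Icc ql qu) {m : ℝ} (hm : 0 < m) (p : Fin T → ℝ)
    (hp : ∀ t, p t ∈ Set.Icc m 1) : Instance K d T a₀ ql qu where
  -- A depletion consumes at least `ql * m` in total, because `m / p t ≥ m`; half of that as budget
  -- makes a single depletion fatal.
  budget := ql * m / 2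
  budget_nonneg := by positivity
  demand := q
  demand_mem := hq
  law a t := if a = a₀ then Measure.dirac (0, fun _ => 0) else killLaw d m (p t)
  law_prob a t := by
    split_ifs
    · infer_instance
    · exact isProbabilityMeasure_killLaw (hm.le.trans (hp t).1) (hp t).2
  mean_reward a t t' := by
    split_ifs
    · rfl
    · rw [integral_reward_killLaw (hm.le.trans (hp t).1) (hp t).2,
        integral_reward_killLaw (hm.le.trans (hp t').1) (hp t').2]
  mean_consumption a i t t' := by
    split_ifs
    · rfl
    · rw [integral_consumption_killLaw hm (hp t).1 (hp t).2,
        integral_consumption_killLaw hm (hp t').1 (hp t').2]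
  law_null t := if_pos rfl

theorem integral_gain_null (I : Instance K d T a₀ ql qu) (t : Fin T) (q v : ℝ) {D : Set (Outcome d)}
    (hD : MeasurableSet D) (h0 : ∀ r, (r, fun _ => 0) ∈ D) :
    ∫ x, gain q v D x ∂(I.law a₀ t) = v := by
  rw [I.law_null, integral_dirac' _ _ (measurable_gain q v hD).stronglyMeasurable]
  simp [gain, h0]

theorem integral_gain_killLaw {m p : ℝ} (h0 : 0 ≤ p) (h1 : p ≤ 1) (q v : ℝ) {D : Set (Outcome d)}
    (hD : MeasurableSet D) (hz : ∀ r, (r, fun _ => 0) ∈ D)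
    (hk : ∀ r, (r, fun _ => Set.projIcc (0 : ℝ) 1 zero_le_one (m / p)) ∉ D) :
    ∫ x, gain q v D x ∂(killLaw d m p) = (1 - p) * (q + v) := by
  rw [integral_killLaw h0 h1 (measurable_gain q v hD)]
  simp [gain, hz, hk]

/-! ### Comparison of the model's reward with the killed process. -/

/-- The outcomes that consume at most `B` of the resource `i` in a round with volume `q`. -/
def cheap (i : Fin d) (q B : ℝ) : Set (Outcome d) := {x | q * (x.2 i : ℝ) ≤ B}

/-- The outcomes that consume nothing. -/
def free (d : ℕ) : Set (Outcome d) := {x | ∀ i, (x.2 i : ℝ) = 0}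

theorem measurableSet_cheap (i : Fin d) (q B : ℝ) : MeasurableSet (cheap i q B) :=
  measurableSet_le (measurable_const.mul (measurable_consumption_coord i)) measurable_const

theorem measurableSet_free : MeasurableSet (free d) := by
  simp only [free, Set.ofPred_forall]
  exact MeasurableSet.iInter fun i =>
    measurableSet_eq_fun (measurable_consumption_coord i) measurable_const

theorem alive_eq_one_iff (D : ℕ → Set (Outcome d)) (n : ℕ) (h : Fin n → Record K d) :
    alive D n h = 1 ↔ ∀ s : Fin n, (h s).2 ∈ D s := by
  induction n with
  | zero => simp [alive]
  | succ n ih =>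
    rw [Fin.forall_fin_succ', alive]
    by_cases hx : (h (Fin.last n)).2 ∈ D n
    · simp only [hx, Set.indicator_of_mem, Pi.one_apply, mul_one, ih, Fin.val_last, and_true]
      rfl
    · simp [hx]

theorem alive_eq_zero_or_one (D : ℕ → Set (Outcome d)) (n : ℕ) (h : Fin n → Record K d) :
    alive D n h = 0 ∨ alive D n h = 1 := by
  induction n with
  | zero => simp [alive]
  | succ n ih =>
    rcases ih (Fin.init h) with h1 | h1 <;> by_cases hx : (h (Fin.last n)).2 ∈ D n <;>
      simp [alive, h1, hx]

open Classical in
theorem earned_castLE (Q : ℕ → ℝ) (D : ℕ → Set (Outcome d)) (h : Fin T → Record K d) (n : ℕ)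
    (hn : n ≤ T) :
    earned Q D n (fun s => h (Fin.castLE hn s)) =
      ∑ t : Fin n, if ∀ s : Fin T, (s : ℕ) ≤ t → (h s).2 ∈ D s then
        Q t * ((h (Fin.castLE hn t)).2.1 : ℝ) else 0 := by
  induction n with
  | zero => simp [earned]
  | succ n ih =>
    have hiff : alive D (n + 1) (fun s => h (Fin.castLE hn s)) = 1 ↔
        ∀ s : Fin T, (s : ℕ) ≤ n → (h s).2 ∈ D s := by
      rw [alive_eq_one_iff]
      exact ⟨fun H s hs => H ⟨s, Nat.lt_succ_of_le hs⟩,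
        fun H s => H (Fin.castLE hn s) (Nat.le_of_lt_succ s.isLt)⟩
    rw [Fin.sum_univ_castSucc, earned]
    congr 1
    · exact ih (Nat.le_of_succ_le hn)
    · simp only [Fin.val_last]
      rcases alive_eq_zero_or_one D (n + 1) (fun s => h (Fin.castLE hn s)) with h0 | h0
      · rw [if_neg (mt hiff.2 (by simp [h0])), h0, zero_mul]
      · rw [if_pos (hiff.1 h0), h0, one_mul]

/-- Consumption is nonnegative, so a round before depletion cannot by itself exceed the budget.
Testing rounds one by one removes the cumulative constraint at the price of an inequality, which
suffices for upper bounds. -/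
theorem reward_le_earned (hql : 0 < ql) (I : Instance K d T a₀ ql qu) (i : Fin d) (Q : ℕ → ℝ)
    (hQ : ∀ t : Fin T, Q t = I.demand t) (h : Fin T → Record K d) :
    I.reward h ≤ earned Q (fun n => cheap i (Q n) I.budget) T h := by
  classical
  have h0 : ∀ t, 0 ≤ I.demand t := fun t => hql.le.trans (I.demand_mem t).1
  have := earned_castLE Q (fun n => cheap i (Q n) I.budget) h T le_rfl
  simp only [Fin.castLE_rfl, id] at this
  rw [this]
  refine Finset.sum_le_sum fun t _ => ?_
  by_cases hb : I.Before h t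
  · rw [if_pos hb, if_pos, hQ]
    intro s hs
    refine le_trans ?_ (hb s hs i)
    rw [hQ]
    exact Finset.single_le_sum (f := fun s => I.demand s * ((h s).2.2 i : ℝ))
      (fun s _ => mul_nonneg (h0 s) ((h s).2.2 i).2.1) (Finset.mem_Iic.2 le_rfl)
  · rw [if_neg hb]
    split_ifs
    · rw [hQ]; exact mul_nonneg (h0 t) (h t).2.1.2.1
    · exact le_rfl

/-- The counterpart for lower bounds: as long as nothing has been consumed, the budget is respected.
-/
theorem earned_le_reward (hql : 0 < ql) (I : Instance K d T a₀ ql qu) (Q : ℕ → ℝ)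
    (hQ : ∀ t : Fin T, Q t = I.demand t) (h : Fin T → Record K d) :
    earned Q (fun _ => free d) T h ≤ I.reward h := by
  classical
  have h0 : ∀ t, 0 ≤ I.demand t := fun t => hql.le.trans (I.demand_mem t).1
  have := earned_castLE Q (fun _ => free d) h T le_rfl
  simp only [Fin.castLE_rfl, id] at this
  rw [this]
  refine Finset.sum_le_sum fun t _ => ?_
  by_cases hb : ∀ s : Fin T, (s : ℕ) ≤ t → (h s).2 ∈ free d
  · rw [if_pos hb, if_pos, hQ]
    intro s hs i
    refine le_of_eq_of_le (Finset.sum_eq_zero fun r hr => ?_) I.budget_nonneg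
    rw [hb r ((Finset.mem_Iic.1 hr).trans hs) i, mul_zero]
  · rw [if_neg hb]
    split_ifs
    · exact mul_nonneg (h0 t) (h t).2.1.2.1
    · exact le_rfl

theorem integrable_reward (hql : 0 < ql) (I : Instance K d T a₀ ql qu)
    (μ : Measure (Fin T → Record K d)) [IsFiniteMeasure μ] : Integrable I.reward μ := by
  refine Integrable.of_bound I.measurable_reward.aestronglyMeasurable (∑ t, I.demand t) <|
    Filter.Eventually.of_forall fun h => ?_
  have h0 : ∀ t, 0 ≤ I.demand t := fun t => hql.le.trans (I.demand_mem t).1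
  refine (norm_sum_le _ _).trans (Finset.sum_le_sum fun t _ => ?_)
  split_ifs
  · rw [Real.norm_of_nonneg (mul_nonneg (h0 t) (h t).2.1.2.1)]
    exact mul_le_of_le_one_right (h0 t) (h t).2.1.2.2
  · simpa using h0 t

theorem expectedReward_le_potential (hql : 0 < ql) (I : Instance K d T a₀ ql qu)
    (σ : Strategy K d T) (i : Fin d) (Q : ℕ → ℝ) (hQ : ∀ t : Fin T, Q t = I.demand t) :
    I.expectedReward σ ≤ potential I σ Q (fun n => cheap i (Q n) I.budget) T le_rfl 0 := by
  refine integral_mono (integrable_reward hql I _)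
    (integrable_potential Q (fun n => measurableSet_cheap i _ _) T 0 _) fun h => ?_
  simpa using reward_le_earned hql I i Q hQ h

theorem potential_le_expectedReward (hql : 0 < ql) (I : Instance K d T a₀ ql qu)
    (σ : Strategy K d T) (Q : ℕ → ℝ) (hQ : ∀ t : Fin T, Q t = I.demand t) :
    potential I σ Q (fun _ => free d) T le_rfl 0 ≤ I.expectedReward σ := by
  refine integral_mono (integrable_potential Q (fun n => measurableSet_free) T 0 _)
    (integrable_reward hql I _) fun h => ?_
  simpa using earned_le_reward hql I Q hQ h

/-! ### Bounds on policies and on the optimum for the hard instances. -/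

/-- The rule that plays a prescribed sequence of actions. -/
def fixedStrategy (d T : ℕ) (act : ℕ → Fin K) : Strategy K d T where
  act t := Kernel.const _ (Measure.dirac (act t))
  markov t := by infer_instance

/-- Playing a prescribed sequence of actions bounds the optimum from below. -/
theorem le_opt (hql : 0 < ql) (I : Instance K d T a₀ ql qu) (Q : ℕ → ℝ)
    (hQ : ∀ t : Fin T, Q t = I.demand t) (v : ℕ → ℝ) (act : ℕ → Fin K) (hT : v T = 0)
    (hv : ∀ i (hi : i < T),
      v i ≤ ∫ x, gain (Q i) (v (i + 1)) (free d) x ∂(I.law (act i) ⟨i, hi⟩)) :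
    v 0 ≤ I.opt := by
  refine le_trans ?_ (le_ciSup (Instance.bddAbove_expectedReward hql I) (fixedStrategy d T act))
  refine le_trans ?_ (potential_le_expectedReward hql I _ Q hQ)
  rw [← hT]
  exact le_potential_of_le I _ Q (fun _ => measurableSet_free) v act (fun _ _ _ => rfl) hv le_rfl

theorem zero_mem_free (r : unitInterval) : ((r, fun _ => 0) : Outcome d) ∈ free d := fun _ => rfl

theorem depleting_notMem_free (hd : 1 ≤ d) {m p : ℝ} (hm : 0 < m) (hp : m ≤ p) (r : unitInterval) :
    ((r, fun _ => Set.projIcc (0 : ℝ) 1 zero_le_one (m / p)) : Outcome d) ∉ free d := by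
  intro h
  have h1 := h ⟨0, hd⟩
  simp only [coe_projIcc_div hm hp] at h1
  have : 0 < m / p := div_pos hm (hm.trans_le hp)
  linarith

theorem zero_mem_cheap (i : Fin d) (q : ℝ) {B : ℝ} (hB : 0 ≤ B) (r : unitInterval) :
    ((r, fun _ => 0) : Outcome d) ∈ cheap i q B := by
  simpa [cheap] using hB

theorem depleting_notMem_cheap (hql : 0 < ql) {q : ℝ} (hq : ql ≤ q) (i : Fin d) {m p : ℝ}
    (hm : 0 < m) (hp : m ≤ p) (h1 : p ≤ 1) (r : unitInterval) :
    ((r, fun _ => Set.projIcc (0 : ℝ) 1 zero_le_one (m / p)) : Outcome d) ∉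
      cheap i q (ql * m / 2) := by
  simp only [cheap, Set.mem_ofPred_eq, coe_projIcc_div hm hp, not_le]
  have h2 : m ≤ m / p := le_div_self hm.le (hm.trans_le hp) h1
  have h3 : ql * m ≤ q * (m / p) := mul_le_mul hq h2 hm.le (hql.le.trans hq)
  have := mul_pos hql hm
  linarith

theorem potential_eq_add (I : Instance K d T a₀ ql qu) (σ : Strategy K d T) (Q : ℕ → ℝ)
    {D : ℕ → Set (Outcome d)} (hD : ∀ n, MeasurableSet (D n)) (n : ℕ) (hn : n ≤ T) (v : ℝ) :
    potential I σ Q D n hn v =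
      potential I σ Q D n hn 0 + v * ∫ h, alive D n h ∂(I.runLaw σ n hn) := by
  simp only [potential, zero_mul, add_zero]
  rw [integral_add (integrable_earned Q hD n _) ((integrable_alive hD n _).const_mul v),
    integral_const_mul]

theorem integral_gain_cheap_killInstance (hql : 0 < ql) {Q : ℕ → ℝ}
    (hQ : ∀ n, Q n ∈ Set.Icc ql qu) {m : ℝ} (hm : 0 < m) {p : ℕ → ℝ}
    (hp : ∀ n, p n ∈ Set.Icc m 1) (i : Fin d) (n : ℕ) (hn : n < T) (v : ℝ) (a : Fin K) :
    ∫ x, gain (Q n) v (cheap i (Q n) (ql * m / 2))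
      x ∂((killInstance K d a₀ hql (fun t : Fin T => Q t) (fun t => hQ t) hm (fun t => p t)
        (fun t => hp t)).law a ⟨n, hn⟩) =
      if a = a₀ then v else (1 - p n) * (Q n + v) := by
  split_ifs with ha
  · subst ha
    exact integral_gain_null _ _ _ _ (measurableSet_cheap _ _ _)
      (zero_mem_cheap _ _ (by positivity))
  · simp only [killInstance, if_neg ha]
    exact integral_gain_killLaw (hm.le.trans (hp n).1) (hp n).2 _ _ (measurableSet_cheap _ _ _)
      (zero_mem_cheap _ _ (by positivity))
      (depleting_notMem_cheap hql (hQ n).1 _ hm (hp n).1 (hp n).2)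

theorem integral_gain_free_killInstance (hd : 1 ≤ d) (hql : 0 < ql) {Q : ℕ → ℝ}
    (hQ : ∀ n, Q n ∈ Set.Icc ql qu) {m : ℝ} (hm : 0 < m) {p : ℕ → ℝ}
    (hp : ∀ n, p n ∈ Set.Icc m 1) (n : ℕ) (hn : n < T) (v : ℝ) (a : Fin K) :
    ∫ x, gain (Q n) v (free d)
      x ∂((killInstance K d a₀ hql (fun t : Fin T => Q t) (fun t => hQ t) hm (fun t => p t)
        (fun t => hp t)).law a ⟨n, hn⟩) =
      if a = a₀ then v else (1 - p n) * (Q n + v) := by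
  split_ifs with ha
  · subst ha
    exact integral_gain_null _ _ _ _ measurableSet_free zero_mem_free
  · simp only [killInstance, if_neg ha]
    exact integral_gain_killLaw (hm.le.trans (hp n).1) (hp n).2 _ _ measurableSet_free
      zero_mem_free (depleting_notMem_free hd hm (hp n).1)

/-- With the depletion probabilities `q / (θ + q)` the reward of the first rounds and the
probability of not depleting the resources in them are in a fixed trade-off. -/
theorem potential_le_of_hazard (hql : 0 < ql) {Q : ℕ → ℝ} (hQ : ∀ n, Q n ∈ Set.Icc ql qu) {m : ℝ}
    (hm : 0 < m) {p : ℕ → ℝ} (hp : ∀ n, p n ∈ Set.Icc m 1) (i : Fin d) {θ : ℝ} (hθ : 0 < θ)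
    {T₀ : ℕ} (hT₀ : T₀ ≤ T) (hpθ : ∀ n < T₀, p n = Q n / (θ + Q n)) (σ : Strategy K d T) :
    potential (killInstance K d a₀ hql (fun t : Fin T => Q t) (fun t => hQ t) hm (fun t => p t)
      (fun t => hp t)) σ Q (fun n => cheap i (Q n) (ql * m / 2)) T₀ hT₀ θ ≤ θ := by
  refine (potential_le_of_le _ σ Q (fun n => measurableSet_cheap i _ _) (fun _ => θ)
    (Nat.zero_le T₀) hT₀ fun n hn _ hn₀ a => ?_).trans (potential_zero _ _ _ _ _).le
  rw [integral_gain_cheap_killInstance hql hQ hm hp]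
  split_ifs
  · exact le_rfl
  · have := hql.trans_le (hQ n).1
    -- The hazard is chosen to make this an equality: `(1 - p) (q + θ) = θ`.
    rw [hpθ n hn₀]
    apply le_of_eq
    field_simp
    ring

/-- If the action depletes the resources for sure after the first rounds, nothing is earned
there. -/
theorem expectedReward_le_of_deadly (hql : 0 < ql) {Q : ℕ → ℝ} (hQ : ∀ n, Q n ∈ Set.Icc ql qu)
    {m : ℝ} (hm : 0 < m) {p : ℕ → ℝ} (hp : ∀ n, p n ∈ Set.Icc m 1) (i : Fin d)
    {T₀ : ℕ} (hT₀ : T₀ ≤ T) (hp1 : ∀ n, T₀ ≤ n → p n = 1) (σ : Strategy K d T) :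
    (killInstance K d a₀ hql (fun t : Fin T => Q t) (fun t => hQ t) hm (fun t => p t)
      (fun t => hp t)).expectedReward σ ≤
    potential (killInstance K d a₀ hql (fun t : Fin T => Q t) (fun t => hQ t) hm (fun t => p t)
      (fun t => hp t)) σ Q (fun n => cheap i (Q n) (ql * m / 2)) T₀ hT₀ 0 := by
  refine (expectedReward_le_potential hql _ σ i Q fun _ => rfl).trans
    (potential_le_of_le _ σ Q (fun n => measurableSet_cheap i _ _) (fun _ => 0)
      hT₀ le_rfl fun n hn hn₀ _ a => ?_)
  refine (integral_gain_cheap_killInstance hql hQ hm hp _ _ _ _ _).trans_le ?_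
  simp [hp1 n hn₀]

/-- After the first rounds at most the remaining volume is earned. -/
theorem expectedReward_le_of_const (hql : 0 < ql) {Q : ℕ → ℝ} (hQ : ∀ n, Q n ∈ Set.Icc ql qu)
    {m : ℝ} (hm : 0 < m) {p : ℕ → ℝ} (hp : ∀ n, p n ∈ Set.Icc m 1) (i : Fin d)
    {T₀ : ℕ} (hT₀ : T₀ ≤ T) {w : ℝ} (hw : ∀ n, T₀ ≤ n → Q n = w) (σ : Strategy K d T) :
    (killInstance K d a₀ hql (fun t : Fin T => Q t) (fun t => hQ t) hm (fun t => p t)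
      (fun t => hp t)).expectedReward σ ≤
    potential (killInstance K d a₀ hql (fun t : Fin T => Q t) (fun t => hQ t) hm (fun t => p t)
      (fun t => hp t)) σ Q (fun n => cheap i (Q n) (ql * m / 2)) T₀ hT₀ (w * ((T : ℝ) - T₀)) := by
  have h := potential_le_of_le (killInstance K d a₀ hql (fun t : Fin T => Q t) (fun t => hQ t) hm
    (fun t => p t) (fun t => hp t)) σ Q (fun n => measurableSet_cheap i (Q n) (ql * m / 2))
    -- The candidate value is the whole volume still to come, as if no depletion could occur.
    (fun n => w * ((T : ℝ) - n)) hT₀ le_rfl fun n hn hn₀ _ a => ?_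
  · simp only [sub_self, mul_zero] at h
    exact (expectedReward_le_potential hql _ σ i Q fun _ => rfl).trans h
  · rw [integral_gain_cheap_killInstance hql hQ hm hp, hw n hn₀]
    have h0 : 0 < w := by rw [← hw n hn₀]; exact hql.trans_le (hQ n).1
    have h1 : ((n + 1 : ℕ) : ℝ) ≤ T := by exact_mod_cast hn
    have h2 := hm.trans_le (hp n).1
    push_cast at h1 ⊢
    split_ifs
    · linarith
    · have : 0 ≤ w + w * ((T : ℝ) - (n + 1)) :=
        add_nonneg h0.le (mul_nonneg h0.le (by linarith))
      nlinarith

/-- Playing in the first rounds only. -/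
theorem le_opt_of_hazard (hd : 1 ≤ d) (hql : 0 < ql) {Q : ℕ → ℝ} (hQ : ∀ n, Q n ∈ Set.Icc ql qu)
    {m : ℝ} (hm : 0 < m) {p : ℕ → ℝ} (hp : ∀ n, p n ∈ Set.Icc m 1) {θ : ℝ} (hθ : 0 < θ)
    {T₀ : ℕ} (hT₀ : T₀ ≤ T) (hpθ : ∀ n < T₀, p n = Q n / (θ + Q n)) {a : Fin K} (ha : a ≠ a₀) :
    θ * (∑ n ∈ Finset.range T₀, Q n) / (θ + ∑ n ∈ Finset.range T₀, Q n) ≤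
    (killInstance K d a₀ hql (fun t : Fin T => Q t) (fun t => hQ t) hm (fun t => p t)
      (fun t => hp t)).opt := by
  have h := le_opt hql (killInstance K d a₀ hql (fun t : Fin T => Q t) (fun t => hQ t) hm
    (fun t => p t) (fun t => hp t)) Q (fun _ => rfl)
    -- Always playing gives equality in the trade-off, so it earns `θ` times the depletion
    -- probability. Survival has probability `∏ θ / (θ + q)`, at most `θ / (θ + S)` for remaining
    -- volume `S`; this gives the candidate value.
    (fun n => θ * (∑ n ∈ Finset.Ico n T₀, Q n) / (θ + ∑ n ∈ Finset.Ico n T₀, Q n)) (fun _ => a)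
    (by simp [Finset.Ico_eq_empty_of_le hT₀]) fun n hn => ?_
  · rw [Finset.range_eq_Ico]
    exact h
  · rw [integral_gain_free_killInstance hd hql hQ hm hp, if_neg ha]
    have hq := hql.trans_le (hQ n).1
    rcases lt_or_ge n T₀ with hn₀ | hn₀
    · rw [Finset.sum_eq_sum_Ico_succ_bot hn₀, hpθ n hn₀]
      have hS : 0 ≤ ∑ k ∈ Finset.Ico (n + 1) T₀, Q k :=
        Finset.sum_nonneg fun k _ => hql.le.trans (hQ k).1
      set S := ∑ k ∈ Finset.Ico (n + 1) T₀, Q k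
      have h1 : (1 - Q n / (θ + Q n)) * (Q n + θ * S / (θ + S)) =
          θ * (Q n * (θ + S) + θ * S) / ((θ + Q n) * (θ + S)) := by
        field_simp
        ring
      rw [h1, div_le_div_iff₀ (by positivity) (by positivity)]
      have h2 : θ * (Q n * (θ + S) + θ * S) * (θ + (Q n + S)) -
          θ * (Q n + S) * ((θ + Q n) * (θ + S)) = θ ^ 2 * (Q n * S) := by ring
      have : 0 ≤ θ ^ 2 * (Q n * S) := by positivity
      linarith
    · rw [Finset.Ico_eq_empty_of_le hn₀, Finset.Ico_eq_empty_of_le (hn₀.trans n.le_succ)]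
      simp only [Finset.sum_empty, mul_zero, zero_div, add_zero]
      exact mul_nonneg (by linarith [(hp n).2]) hq.le

/-- Playing after the first rounds only. -/
theorem le_opt_of_const (hd : 1 ≤ d) (hql : 0 < ql) {Q : ℕ → ℝ} (hQ : ∀ n, Q n ∈ Set.Icc ql qu)
    {m : ℝ} (hm : 0 < m) {p : ℕ → ℝ} (hp : ∀ n, p n ∈ Set.Icc m 1)
    {T₀ : ℕ} (hT₀ : T₀ ≤ T) (hpm : ∀ n, T₀ ≤ n → p n = m) {w : ℝ} (hw : ∀ n, T₀ ≤ n → Q n = w)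
    {a : Fin K} (ha : a ≠ a₀) :
    (w - m * (w * ((T : ℝ) - T₀))) * ((T : ℝ) - T₀) ≤
    (killInstance K d a₀ hql (fun t : Fin T => Q t) (fun t => hQ t) hm (fun t => p t)
      (fun t => hp t)).opt := by
  have h := le_opt hql (killInstance K d a₀ hql (fun t : Fin T => Q t) (fun t => hQ t) hm
    (fun t => p t) (fun t => hp t)) Q (fun _ => rfl)
    -- A value linear in the number of rounds left: each round is charged `m` times the full late
    -- volume, which dominates the loss through depletion. The maximum keeps it constant while the
    -- null action is played.
    (fun n => (w - m * (w * ((T : ℝ) - T₀))) * ((T : ℝ) - (max n T₀ : ℕ)))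
    (fun n => if n < T₀ then a₀ else a)
    (by simp [max_eq_left hT₀]) fun n hn => ?_
  · simpa using h
  · rw [integral_gain_free_killInstance hd hql hQ hm hp]
    rcases lt_or_ge n T₀ with hn₀ | hn₀
    · simp [hn₀, max_eq_right hn₀.le]
    · rw [if_neg hn₀.not_gt, if_neg ha, hpm n hn₀, hw n hn₀, max_eq_left hn₀,
        max_eq_left (hn₀.trans n.le_succ)]
      have h0 : 0 < w := by rw [← hw n hn₀]; exact hql.trans_le (hQ n).1
      have h1 : ((n + 1 : ℕ) : ℝ) ≤ T := by exact_mod_cast hn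
      have h2 : (T₀ : ℝ) ≤ n := by exact_mod_cast hn₀
      push_cast at h1 ⊢
      have h3 : 0 ≤ m * w * ((n : ℝ) - T₀) := by have := sub_nonneg.2 h2; positivity
      have h4 : 0 ≤ m * (m * (w * ((T : ℝ) - T₀))) * ((T : ℝ) - (n + 1)) := by
        have := sub_nonneg.2 h1
        have : 0 ≤ (T : ℝ) - T₀ := by linarith
        positivity
      nlinarith

end BwK

/-! ### The choice of parameters and the two-instance argument. -/

theorem theorem1 :
    ∃ c : ℝ, 0 < c ∧
      ∀ (K d T : ℕ) (a₀ : Fin K) (ql qu : ℝ), 2 ≤ K → 1 ≤ d → 0 < ql → ql < qu →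
      ∀ (F : BwK.Oracle T ql qu)
        -- the online algorithm knows the budget, so there is a policy for every budget
        (alg : ℝ → BwK.Policy K d T)
        (T₀ : ℕ) (_ : 1 ≤ T₀) (hT₀ : T₀ < T)
        (q : Fin T₀ → ℝ) (_ : ∀ t, q t ∈ Set.Icc ql qu)
        (ε : ℝ), 0 < ε → BwK.WellResponse F T₀ q ε →
      ∃ I : BwK.Instance K d T a₀ ql qu,
        0 < I.budget ∧
        BwK.pre I.demand T₀ hT₀.le = q ∧
        I.WellEstimated F T₀ hT₀.le ε ∧
        c * max ((1 / I.total) * ∑ t, q t * ε) I.Lam ≤ I.regret F (alg I.budget) := by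
  -- The regret will be at least `OPT / 5`, and both terms of the maximum at most `3 OPT`.
  refine ⟨1 / 15, by norm_num, ?_⟩
  intro K d T a₀ ql qu hK hd hql hqu F alg T₀ hT₀1 hT₀ q hq ε hε hwr
  obtain ⟨hw1, hw2, -⟩ : ε ≤ F.pred T₀ q - ∑ s, q s - ql * ((T : ℝ) - T₀) ∧
      ε ≤ qu * ((T : ℝ) - T₀) - (F.pred T₀ q - ∑ s, q s) ∧ ε ≤ F.pred T₀ q / 2 := by
    simpa [BwK.WellResponse] using hwr
  have hN : 0 < (T : ℝ) - T₀ := sub_pos.2 (by exact_mod_cast hT₀)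
  have : Nontrivial (Fin K) := Fin.nontrivial_iff_two_le.2 hK
  obtain ⟨a, ha⟩ := exists_ne a₀
  set N : ℝ := (T : ℝ) - T₀ with hNdef
  set S : ℝ := ∑ s, q s with hSdef
  -- The late volume that makes the total exceed the prediction by exactly `ε`. The well-response
  -- bounds allow it to be spread evenly over the late rounds with volumes in `[ql, qu]`.
  set W : ℝ := F.pred T₀ q + ε - S with hWdef
  have hS : 0 < S := by
    have : Nonempty (Fin T₀) := ⟨⟨0, hT₀1⟩⟩
    exact Finset.sum_pos (fun t _ => hql.trans_le (hq t).1) Finset.univ_nonempty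
  have hWε : ε ≤ W := by nlinarith [mul_pos hql hN]
  have hW : 0 < W := hε.trans_le hWε
  set w : ℝ := W / N with hwdef
  have hwN : w * N = W := div_mul_cancel₀ _ hN.ne'
  have hwmem : w ∈ Set.Icc ql qu :=
    ⟨(le_div_iff₀ hN).2 (by linarith), (div_le_iff₀ hN).2 (by linarith)⟩
  -- Comparable to `min S W`: at most half of each, yet `2 θ = S W / Q` still dominates `S ε / Q`.
  set θ : ℝ := S * W / (2 * (S + W)) with hθdef
  have hθ : 0 < θ := by positivity
  have hθS : 2 * θ ≤ S := by
    rw [hθdef, ← sub_nonneg]; field_simp; nlinarith [mul_pos hS hS]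
  have hθW : 2 * θ ≤ W := by
    rw [hθdef, ← sub_nonneg]; field_simp; nlinarith [mul_pos hW hW]
  -- volumes and depletion probabilities
  obtain ⟨Q, hQq, hQw⟩ : ∃ Q : ℕ → ℝ, (∀ t : Fin T₀, Q t = q t) ∧ ∀ n, T₀ ≤ n → Q n = w :=
    ⟨fun n => if h : n < T₀ then q ⟨n, h⟩ else w, fun t => by simp,
      fun n hn => by simp [hn.not_gt]⟩
  have hQ : ∀ n, Q n ∈ Set.Icc ql qu := fun n => by
    rcases lt_or_ge n T₀ with h | h
    · rw [hQq ⟨n, h⟩]; exact hq _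
    · rw [hQw n h]; exact hwmem
  have hT : 0 < (T : ℝ) := by exact_mod_cast (Nat.zero_le _).trans_lt hT₀
  -- The first bound limits the loss in the harmless future to `W / 16`; the second keeps `m` below
  -- all early hazards, as `x / (θ + x)` is increasing, so that `m / p ≤ 1`.
  set m : ℝ := min (1 / (16 * (T : ℝ))) (ql / (θ + ql)) with hmdef
  have hm : 0 < m := lt_min (by positivity) (by positivity)
  have hm1 : m ≤ 1 := (min_le_right _ _).trans (div_le_one_of_le₀ (by linarith) (by positivity))
  have hmN : m * N ≤ 1 / 16 := by
    have h1 : m ≤ 1 / (16 * (T : ℝ)) := min_le_left _ _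
    have h2 : N ≤ T := by rw [hNdef]; linarith [(Nat.cast_nonneg T₀ : (0 : ℝ) ≤ T₀)]
    calc m * N ≤ 1 / (16 * (T : ℝ)) * T := mul_le_mul h1 h2 hN.le (by positivity)
      _ = 1 / 16 := by field_simp
  let p : ℝ → ℕ → ℝ := fun b n => if n < T₀ then Q n / (θ + Q n) else b
  have hp : ∀ b ∈ Set.Icc m 1, ∀ n, p b n ∈ Set.Icc m 1 := fun b hb n => by
    have h1 := hql.trans_le (hQ n).1
    by_cases h : n < T₀
    · simp only [p, if_pos h]
      refine ⟨(min_le_right _ _).trans ?_, div_le_one_of_le₀ (by linarith) (by positivity)⟩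
      rw [div_le_div_iff₀ (by positivity) (by positivity)]
      nlinarith [(hQ n).1]
    · simpa only [p, if_neg h] using hb
  have hpθ : ∀ b, ∀ n < T₀, p b n = Q n / (θ + Q n) := fun b n hn => if_pos hn
  have hpb : ∀ b n, T₀ ≤ n → p b n = b := fun b n hn => if_neg hn.not_gt
  have hb1 : (1 : ℝ) ∈ Set.Icc m 1 := ⟨hm1, le_rfl⟩
  have hbm : m ∈ Set.Icc m 1 := ⟨le_rfl, hm1⟩
  let I : ∀ b ∈ Set.Icc m 1, BwK.Instance K d T a₀ ql qu := fun b hb =>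
    BwK.killInstance K d a₀ hql (fun t : Fin T => Q t) (fun t => hQ t) hm (fun t => p b t)
      (fun t => hp b hb t)
  have hsumS : ∑ n ∈ Finset.range T₀, Q n = S := by
    rw [Finset.sum_range]; exact Finset.sum_congr rfl fun t _ => hQq t
  have htotal : ∀ b hb, (I b hb).total = S + W := fun b hb => by
    change ∑ t : Fin T, Q t = _
    rw [← Finset.sum_range (fun n => Q n), ← Finset.sum_range_add_sum_Ico _ hT₀.le, hsumS,
      Finset.sum_congr rfl fun n hn => hQw n (Finset.mem_Ico.1 hn).1]
    simp only [Finset.sum_const, Nat.card_Ico, nsmul_eq_mul, Nat.cast_sub hT₀.le]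
    rw [← hwN, mul_comm w]
  have hpre : ∀ b hb, BwK.pre (I b hb).demand T₀ hT₀.le = q := fun b hb => funext fun t => hQq t
  have hest : ∀ b hb, (I b hb).WellEstimated F T₀ hT₀.le ε := fun b hb => by
    rw [BwK.Instance.WellEstimated, hpre b hb, htotal b hb, hWdef]
    have : S + (F.pred T₀ q + ε - S) - F.pred T₀ q = ε := by ring
    rw [this, abs_of_pos hε]
    exact ⟨le_rfl, by linarith⟩
  -- it suffices that the algorithm misses a constant fraction of the optimum
  suffices hmain : ∃ b, ∃ hb : b ∈ Set.Icc m 1, 2 / 3 * θ ≤ (I b hb).opt ∧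
      (I b hb).expectedReward ((alg (I b hb).budget).run F (I b hb).demand) ≤
        4 / 5 * (I b hb).opt by
    obtain ⟨b, hb, h1, h2⟩ := hmain
    refine ⟨I b hb, half_pos (mul_pos hql hm), hpre b hb, hest b hb, ?_⟩
    have h3 : 1 / (I b hb).total * ∑ t, q t * ε ≤ 3 * (I b hb).opt := by
      rw [htotal b hb, ← Finset.sum_mul, ← hSdef]
      have h4 : 1 / (S + W) * (S * ε) ≤ 2 * θ := by
        rw [hθdef]
        have h5 : 2 * (S * W / (2 * (S + W))) = 1 / (S + W) * (S * W) := by field_simp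
        rw [h5]
        exact mul_le_mul_of_nonneg_left (mul_le_mul_of_nonneg_left hWε hS.le) (by positivity)
      linarith
    have h4 : (I b hb).Lam ≤ 3 * (I b hb).opt := (min_le_left _ _).trans (by linarith)
    have := max_le h3 h4
    rw [BwK.Instance.regret]
    linarith
  let i : Fin d := ⟨0, hd⟩
  -- Budget and volumes do not depend on `b`, so the algorithm runs the same rule on both instances.
  let σ : BwK.Strategy K d T := (alg (ql * m / 2)).run F fun t : Fin T => Q t
  let D : ℕ → Set (BwK.Outcome d) := fun n => BwK.cheap i (Q n) (ql * m / 2)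
  have hD : ∀ n, MeasurableSet (D n) := fun n => BwK.measurableSet_cheap _ _ _
  have hlaw : (I m hbm).runLaw σ T₀ hT₀.le = (I 1 hb1).runLaw σ T₀ hT₀.le := by
    refine BwK.runLaw_congr _ _ _ _ _ fun a t ht => ?_
    simp only [I, BwK.killInstance, hpθ _ _ ht]
  set A := BwK.potential (I 1 hb1) σ Q D T₀ hT₀.le 0 with hA
  set α := ∫ h, BwK.alive D T₀ h ∂((I 1 hb1).runLaw σ T₀ hT₀.le) with hα
  have htrade : A + θ * α ≤ θ := by
    rw [hA, hα, ← BwK.potential_eq_add _ σ Q hD]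
    exact BwK.potential_le_of_hazard hql hQ hm (hp 1 hb1) i hθ hT₀.le (hpθ 1) σ
  by_cases hcase : A ≤ θ / 2
  -- Timid case, deadly future: the algorithm gets at most `θ / 2`, whereas `2 θ ≤ S` gives `OPT ≥ 2
  -- θ / 3`.
  · have hopt := BwK.le_opt_of_hazard (a₀ := a₀) hd hql hQ hm (hp 1 hb1) hθ hT₀.le (hpθ 1) ha
    rw [hsumS] at hopt
    have h1 : 2 / 3 * θ ≤ θ * S / (θ + S) := by
      rw [le_div_iff₀ (by positivity)]; nlinarith
    refine ⟨1, hb1, h1.trans hopt, ?_⟩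
    have h2 : (I 1 hb1).expectedReward σ ≤ A :=
      BwK.expectedReward_le_of_deadly hql hQ hm (hp 1 hb1) i hT₀.le (hpb 1) σ
    have h3 : 2 / 3 * θ ≤ (I 1 hb1).opt := h1.trans hopt
    exact h2.trans (by linarith)
  -- Greedy case, harmless future: the algorithm gets at most `3 W / 4`, which is exactly `4 / 5` of
  -- the lower bound `15 W / 16` for `OPT`.
  · have hopt := BwK.le_opt_of_const (a₀ := a₀) hd hql hQ hm (hp m hbm) hT₀.le (hpb m) hQw ha
    have h1 : 15 / 16 * W ≤ (I m hbm).opt := by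
      refine le_trans ?_ hopt
      rw [← hNdef, hwN, sub_mul, hwN]
      nlinarith
    refine ⟨m, hbm, by linarith, ?_⟩
    have h2 : (I m hbm).expectedReward σ ≤ BwK.potential (I m hbm) σ Q D T₀ hT₀.le (w * N) :=
      BwK.expectedReward_le_of_const hql hQ hm (hp m hbm) i hT₀.le hQw σ
    have h3 : BwK.potential (I m hbm) σ Q D T₀ hT₀.le (w * N) = A + W * α := by
      rw [BwK.potential_eq_add _ σ Q hD, hwN, hA, hα]
      simp only [BwK.potential, hlaw]
    have h4 : α ≤ 1 / 2 := by
      by_contra hc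
      have := mul_lt_mul_of_pos_left (not_le.1 hc) hθ
      linarith [not_le.1 hcase]
    -- By the trade-off, `A + W α ≤ θ + (W - θ) α ≤ (W + θ) / 2`, and `θ ≤ W / 2`.
    have h5 : A + W * α ≤ 3 / 4 * W := by
      have h6 : (W - θ) * α ≤ (W - θ) * (1 / 2) := mul_le_mul_of_nonneg_left h4 (by linarith)
      have h7 : (W - θ) * α = W * α - θ * α := sub_mul _ _ _
      linarith
    exact (h2.trans (h3.trans_le h5)).trans (by linarith)

end
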